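/- Let $G$ be a group and let $S$ be a finite right $G$-set. For a field $K$, let $K[S]$ be the corresponding permutation module, that is, the right $G$-module of formal $K$-linear combinations of elements of $S$. For $v \in K[S]$, let $t(v)$ denote the number of elements of $S$ that occur in $v$ with nonzero coefficient, and let $d(v)$ denote the dimension over $K$ of the $G$-submodule of $K[S]$ generated by $v$. Let $\pi$ be the permutation character of $G$ on $S$, that is, the character of $G$ afforded by $\mathbb{C}[S]$. Suppose that $\pi$ is multiplicity-free (each irreducible complex character of $G$ occurs with multiplicity at most $1$ in $\pi$), and let $F \subseteq \mathbb{C}$ be the subfield generated by the values of all of the irreducible constituents of $\pi$. Then for every nonzero $v \in \mathbb{C}[S]$ there exists a nonzero $v_0 \in F[S]$ such that $t(v_0) \le t(v)$ and $d(v_0) \le d(v)$. -/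

import Mathlib

open MulOpposite

noncomputable section

namespace PermModule

/-! A right `G`-set `S` is a set with an action of the opposite group `Gᵐᵒᵖ`; the point `s g` is
`op g • s`. The permutation module `F[S]` is the space `S →₀ F` of formal linear combinations. -/

/-- The action of `g` on the right `G`-module `F[S]`: the `F`-linear map `v ↦ v g` that sends each
basis element `s ∈ S` to `s g`. -/
def translate (F : Type*) [Field F] {G S : Type*} [Group G] [MulAction Gᵐᵒᵖ S] (g : G) :
    (S →₀ F) →ₗ[F] (S →₀ F) :=
  Finsupp.lmapDomain F F (fun s : S => op g • s)

/-- `t(v)`: the number of points of `S` that occur in `v` with nonzero coefficient. -/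
def suppSize {F S : Type*} [Field F] (v : S →₀ F) : ℕ :=
  v.support.card

/-- The `G`-submodule of `F[S]` generated by `v`: the linear span of the `G`-translates of `v`. -/
def genSubmodule {F S : Type*} [Field F] (G : Type*) [Group G] [MulAction Gᵐᵒᵖ S] (v : S →₀ F) :
    Submodule F (S →₀ F) :=
  Submodule.span F (Set.range fun g : G => translate F g v)

/-- `d(v)`: the dimension over `F` of the `G`-submodule of `F[S]` generated by `v`. -/
def genDim {F S : Type*} [Field F] (G : Type*) [Group G] [MulAction Gᵐᵒᵖ S] (v : S →₀ F) : ℕ :=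
  Module.finrank F (genSubmodule G v)

/-- The permutation character of the right `G`-set `S`: the character of `G` afforded by `ℂ[S]`. -/
def permChar (G S : Type*) [Group G] [MulAction Gᵐᵒᵖ S] : G → ℂ :=
  fun g => LinearMap.trace ℂ (S →₀ ℂ) (translate ℂ g)

/-- `Irr(G)`: the characters of the irreducible finite dimensional complex representations. -/
def irrChars (G : Type*) [Group G] : Set (G → ℂ) :=
  {χ | ∃ (n : ℕ) (ρ : Representation ℂ G (Fin n → ℂ)), ρ.IsIrreducible ∧ ρ.character = χ}

/-- `π` is the sum of the irreducible characters listed, with multiplicities, in `X`. For a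
character `π` there is exactly one such `X`, and the multiplicity of `χ` in `π` is the number of
times that `χ` occurs in `X`. -/
def IsIrrDecomposition {G : Type*} [Group G] (π : G → ℂ) (X : Multiset (G → ℂ)) : Prop :=
  (∀ χ ∈ X, χ ∈ irrChars G) ∧ X.sum = π

/-- The irreducible constituents of a character `π`. -/
def irrConstituents {G : Type*} [Group G] (π : G → ℂ) : Set (G → ℂ) :=
  {χ | ∃ X : Multiset (G → ℂ), IsIrrDecomposition π X ∧ χ ∈ X}

/-- The character `π` is multiplicity-free: no irreducible character occurs more than once in the
decomposition of `π` into irreducible characters. -/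
def IsMultiplicityFree {G : Type*} [Group G] (π : G → ℂ) : Prop :=
  ∀ X : Multiset (G → ℂ), IsIrrDecomposition π X → X.Nodup

/-- The subfield of `ℂ` generated by all the values of all the irreducible constituents of `π`. -/
def constituentField {G : Type*} [Group G] (π : G → ℂ) : Subfield ℂ :=
  Subfield.closure {z | ∃ χ ∈ irrConstituents π, ∃ g : G, χ g = z}

end PermModule

end

/-!
Let `M ≤ ℂ[S]` be the `G`-submodule generated by `v`. By Maschke's theorem, applied to the finite
group `H` of permutations of `S` induced by `G`, the module `ℂ[S]` is a direct sum of irreducible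
submodules `W i`, and multiplicity-freeness says that their characters `χ i` are distinct. By
Schur's lemma and the orthogonality relations, `χ i (1) / |H| * ∑ h, χ i (h⁻¹) h` then acts on
`ℂ[S]` as the projection onto `W i` (`charIdempotent_apply_of_isIrreducible`). Since `M` is stable
under these projections, it is the sum of the `W i` it contains, so the sum `P` of the corresponding
projections satisfies `M = {x | P x = x}`, and `P = ∑ h, c h • h` with all `c h` in the field `F`
generated by the character values (`exists_mem_iff_sum_smul_eq`). In other words, `M` is cut out by
linear equations over `F`.

Choose an `F`-linear functional `φ : ℂ → F` that does not kill all coordinates of `v`, and apply it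
coordinatewise. The result `v₀` is nonzero, its support lies in that of `v`, and it satisfies the
same equations over `F`, so `v₀ ∈ M` (`exists_descent`). Vectors of `F[S]` that are independent over
`F` remain so over `ℂ`, and the `F`-span of the translates of `v₀` lies in `M`, so its dimension is
at most `dim M` (`finrank_le_of_extendScalars_mem`).

`ℂ[S]` is a right module, so it is made into a representation by letting `g` act as `g⁻¹` from the
right. That replaces `π(g)` by `π(g⁻¹)`, which is the same number for a permutation character.
-/

namespace PermModule

open Module

/-! ### Irreducible representations and Maschke's theorem -/

section Irreducible

universe u

variable {k G H W : Type*} {V : Type u} [Field k] [Group G] [Group H] [AddCommGroup V]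
  [Module k V] [AddCommGroup W] [Module k W]

theorem nontrivial_of_isIrreducible {ρ : Representation k G V} (hρ : ρ.IsIrreducible) :
    Nontrivial V := by
  by_contra h
  rw [not_nontrivial_iff_subsingleton] at h
  have := hρ.toNontrivial
  exact (bot_ne_top : (⊥ : Subrepresentation ρ) ≠ ⊤)
    (Subrepresentation.toSubmodule_injective (Subsingleton.elim _ _))

/-- Irreducibility passes along an isomorphism that is equivariant over a surjective group
homomorphism. -/
theorem isIrreducible_of_equivariant_equiv {ρ : Representation k H V} {σ : Representation k G W}
    (hρ : ρ.IsIrreducible) (f : G →* H) (hf : Function.Surjective f) (e : V ≃ₗ[k] W)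
    (he : ∀ g x, e (ρ (f g) x) = σ g (e x)) : σ.IsIrreducible := by
  let T (U : Subrepresentation σ) : Subrepresentation ρ :=
    { toSubmodule := U.toSubmodule.comap e.toLinearMap
      apply_mem_toSubmodule := by
        intro h x hx
        obtain ⟨g, rfl⟩ := hf h
        change e _ ∈ U.toSubmodule
        rw [he]
        exact U.apply_mem_toSubmodule g hx }
  have hT (U : Subrepresentation σ) (x : V) : x ∈ (T U).toSubmodule ↔ e x ∈ U.toSubmodule := Iff.rfl
  have hnt : Nontrivial (Subrepresentation ρ) := hρ.toNontrivial
  refine { exists_pair_ne := ⟨⊥, ⊤, fun h => ?_⟩, eq_bot_or_eq_top := fun U => ?_ }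
  · apply (bot_ne_top : (⊥ : Subrepresentation ρ) ≠ ⊤)
    apply Subrepresentation.toSubmodule_injective
    ext x
    have h2 := congrArg Subrepresentation.toSubmodule h
    have h3 : e x ∈ (⊥ : Submodule k W) ↔ e x ∈ (⊤ : Submodule k W) :=
      iff_of_eq (congrArg (e x ∈ ·) h2)
    change x ∈ (⊥ : Submodule k V) ↔ x ∈ (⊤ : Submodule k V)
    simpa using h3
  · refine (hρ.eq_bot_or_eq_top (T U)).imp (fun h => ?_) (fun h => ?_) <;>
    · apply Subrepresentation.toSubmodule_injective
      ext y
      obtain ⟨x, rfl⟩ := e.surjective y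
      rw [← hT, h]
      first
      | change x ∈ (⊥ : Submodule k V) ↔ e x ∈ (⊥ : Submodule k W)
        simp
      | change x ∈ (⊤ : Submodule k V) ↔ e x ∈ (⊤ : Submodule k W)
        simp

theorem isIrreducible_toRepresentation_of_isAtom {ρ : Representation k G V}
    {W : Subrepresentation ρ} (hW : IsAtom W) : W.toRepresentation.IsIrreducible := by
  let T (U : Subrepresentation W.toRepresentation) : Subrepresentation ρ :=
    { toSubmodule := U.toSubmodule.map W.toSubmodule.subtype
      apply_mem_toSubmodule := by
        rintro g _ ⟨x, hx, rfl⟩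
        exact ⟨W.toRepresentation g x, U.apply_mem_toSubmodule g hx, rfl⟩ }
  have hT (U : Subrepresentation W.toRepresentation) (x : W.toSubmodule) :
      (x : V) ∈ (T U).toSubmodule ↔ x ∈ U.toSubmodule := by
    constructor
    · rintro ⟨y, hy, hyx⟩
      rwa [← Subtype.ext hyx]
    · exact fun hx => ⟨x, hx, rfl⟩
  have hle (U) : T U ≤ W := by
    rintro _ ⟨x, -, rfl⟩
    exact x.2
  refine { exists_pair_ne := ⟨⊥, ⊤, fun h => hW.1 ?_⟩, eq_bot_or_eq_top := fun U => ?_ }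
  · apply Subrepresentation.toSubmodule_injective
    refine (Submodule.eq_bot_iff _).2 fun x hx => ?_
    have h2 : (⟨x, hx⟩ : W.toSubmodule) ∈ (⊥ : Submodule k W.toSubmodule) :=
      (iff_of_eq (congrArg ((⟨x, hx⟩ : W.toSubmodule) ∈ ·)
        (congrArg Subrepresentation.toSubmodule h))).2 trivial
    simpa using h2
  · refine (hW.le_iff.1 (hle U)).imp (fun h => ?_) (fun h => ?_) <;>
    · apply Subrepresentation.toSubmodule_injective
      ext x
      rw [← hT, h]
      first
      | change (x : V) ∈ (⊥ : Submodule k V) ↔ x ∈ (⊥ : Submodule k W.toSubmodule)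
        simp
      | change (x : V) ∈ W.toSubmodule ↔ x ∈ (⊤ : Submodule k W.toSubmodule)
        simp

/-- Maschke's theorem as an internal direct sum decomposition into finitely many irreducible
subrepresentations. -/
theorem exists_isInternal_irreducible [Finite G] [CharZero k] [FiniteDimensional k V]
    (ρ : Representation k G V) :
    ∃ (ι : Type u) (_ : Fintype ι) (_ : DecidableEq ι) (W : ι → Subrepresentation ρ),
      (∀ i, (W i).toRepresentation.IsIrreducible) ∧
        DirectSum.IsInternal fun i => (W i).toSubmodule := by
  classical
  have : NeZero (Nat.card G : k) := ⟨Nat.cast_ne_zero.2 Nat.card_pos.ne'⟩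
  obtain ⟨s, hind, htop, hs⟩ :=
    IsSemisimpleModule.exists_sSupIndep_sSup_simples_eq_top (MonoidAlgebra k G) ρ.asModule
  have hW : DirectSum.IsInternal fun i : s =>
      (Subrepresentation.ofSubmodule' (i : Submodule (MonoidAlgebra k G) ρ.asModule)).toSubmodule :=
    DirectSum.isInternal_submodule_of_iSupIndep_of_iSup_eq_top
      (A := fun i : s => (i : Submodule (MonoidAlgebra k G) ρ.asModule))
      ((sSupIndep_iff _).1 hind) (by rw [← htop, sSup_eq_iSup'])
  have hirr (i : s) : (Subrepresentation.ofSubmodule'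
      (i : Submodule (MonoidAlgebra k G) ρ.asModule)).toRepresentation.IsIrreducible := by
    apply isIrreducible_toRepresentation_of_isAtom
    exact (OrderIso.isAtom_iff Subrepresentation.subrepresentationSubmoduleOrderIso.symm _).2
      (isSimpleModule_iff_isAtom.1 (hs i i.2))
  have hfin : Finite s :=
    WellFoundedGT.finite_of_iSupIndep hW.submodule_iSupIndep fun i =>
      (Submodule.nontrivial_iff_ne_bot).1 (nontrivial_of_isIrreducible (hirr i))
  exact ⟨s, Fintype.ofFinite s, inferInstance, _, hirr, hW⟩

end Irreducible

/-! ### Central idempotents of irreducible characters -/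

section Idempotent

variable {k G V : Type*} [Field k] [Group G] [Fintype G] [AddCommGroup V] [Module k V]

/-- The action on a representation `ρ` of the central idempotent
`χ(1) / |G| * ∑ g, χ(g⁻¹) g` of the group algebra attached to an irreducible character `χ`;
the formula is used for any function `χ : G → k`. -/
noncomputable def charIdempotent (ρ : Representation k G V) (χ : G → k) : V →ₗ[k] V :=
  ∑ g : G, (χ 1 * (Nat.card G : k)⁻¹ * χ g⁻¹) • ρ g

theorem charIdempotent_comm (ρ : Representation k G V) {χ : G → k}
    (hχ : ∀ g h, χ (h * g * h⁻¹) = χ g) (h : G) (x : V) :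
    charIdempotent ρ χ (ρ h x) = ρ h (charIdempotent ρ χ x) := by
  simp only [charIdempotent, LinearMap.sum_apply, LinearMap.smul_apply, map_sum, map_smul]
  refine Fintype.sum_equiv (MulAut.conj h⁻¹).toEquiv _ _ fun g => ?_
  have h1 : ρ h (ρ ((MulAut.conj h⁻¹) g) x) = ρ g (ρ h x) := by
    simp only [← Module.End.mul_apply, ← map_mul]
    congr 2
    simp [mul_assoc]
  have h2 : χ ((MulAut.conj h⁻¹) g)⁻¹ = χ g⁻¹ := by
    rw [← hχ g⁻¹ h⁻¹]
    simp [mul_assoc]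
  simp only [MulEquiv.toEquiv_eq_coe, MulEquiv.coe_toEquiv]
  rw [h1, h2]

variable [IsAlgClosed k] [FiniteDimensional k V]

/-- Schur's lemma, applied to the intertwining operator given by a class function `χ`. -/
theorem exists_charIdempotent_eq_smul {ρ : Representation k G V} (hρ : ρ.IsIrreducible)
    {χ : G → k} (hχ : ∀ g h, χ (h * g * h⁻¹) = χ g) :
    ∃ c : k, ∀ x, charIdempotent ρ χ x = c • x := by
  obtain ⟨c, hc⟩ :=
    (Representation.IsIrreducible.algebraMap_intertwiningMap_bijective_of_isAlgClosed
      (ρ := ρ)).2 ((charIdempotent ρ χ).intertwiningMap_of_isIntertwiningMap _ _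
        (charIdempotent_comm ρ hχ))
  exact ⟨c, fun x => (congrArg (fun f => f x) hc).symm⟩

open scoped Classical in
/-- By Schur's lemma the idempotent of `σ` acts on `ρ` as a scalar; its trace is computed by the
orthogonality relations. -/
theorem charIdempotent_apply_of_isIrreducible [CharZero k] {V' : Type*} [AddCommGroup V']
    [Module k V'] [FiniteDimensional k V'] {ρ : Representation k G V}
    (hρ : ρ.IsIrreducible) {σ : Representation k G V'} (hσ : σ.IsIrreducible) (x : V) :
    charIdempotent ρ σ.character x = if ρ.character = σ.character then x else 0 := by
  have hn : (Nat.card G : k) ≠ 0 := Nat.cast_ne_zero.2 Nat.card_pos.ne'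
  have := invertibleOfNonzero hn
  obtain ⟨c, hc⟩ := exists_charIdempotent_eq_smul hρ (fun g h => σ.char_conj g h)
  have htr : c * finrank k V = σ.character 1 *
      ((Nat.card G : k)⁻¹ * ∑ g : G, ρ.character g * σ.character g⁻¹) := by
    have h1 : charIdempotent ρ σ.character = c • LinearMap.id := LinearMap.ext hc
    have h2 := congrArg (LinearMap.trace k V) h1
    rw [charIdempotent, map_sum, map_smul, LinearMap.trace_id, smul_eq_mul] at h2
    rw [← h2, Finset.mul_sum, Finset.mul_sum]
    refine Finset.sum_congr rfl fun g _ => ?_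
    simp only [map_smul, smul_eq_mul, Representation.character]
    ring
  have := nontrivial_of_isIrreducible hρ
  have hd : (finrank k V : k) ≠ 0 := Nat.cast_ne_zero.2 finrank_pos.ne'
  split_ifs with h
  · rw [← h, Representation.char_orthonormal ρ ρ, if_pos ⟨.refl ρ⟩, Representation.char_one,
      mul_one] at htr
    rw [hc, mul_right_cancel₀ hd (htr.trans (one_mul _).symm), one_smul]
  · rw [Representation.char_orthonormal ρ σ, if_neg, mul_zero] at htr
    · rw [hc, (mul_eq_zero.1 htr).resolve_right hd, zero_smul]
    · rintro ⟨φ⟩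
      exact h (Representation.char_iso φ).symm

/-- In a direct sum of irreducible representations with distinct `F`-valued characters, every
subrepresentation is the fixed space of an element of the group algebra with coefficients in
`F`, namely the sum of the central idempotents of the summands it contains. -/
theorem exists_mem_iff_sum_smul_eq [CharZero k] {ι : Type*} [Fintype ι] [DecidableEq ι]
    {ρ : Representation k G V} {W : ι → Subrepresentation ρ}
    (hirr : ∀ i, (W i).toRepresentation.IsIrreducible)
    (hW : DirectSum.IsInternal fun i => (W i).toSubmodule)
    (hinj : Function.Injective fun i => (W i).toRepresentation.character)
    (F : Subfield k) (hF : ∀ i g, (W i).toRepresentation.character g ∈ F)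
    (M : Subrepresentation ρ) :
    ∃ c : G → F, ∀ x, x ∈ M.toSubmodule ↔ ∑ g, (c g : k) • ρ g x = x := by
  classical
  set χ : ι → G → k := fun i => (W i).toRepresentation.character with hχ
  have hsup : ⨆ i, (W i).toSubmodule = ⊤ := hW.submodule_iSup_eq_top
  have hcoe (i j : ι) (x : (W j).toSubmodule) :
      charIdempotent ρ (χ i) x = charIdempotent (W j).toRepresentation (χ i) x := by
    simp only [charIdempotent, LinearMap.sum_apply, LinearMap.smul_apply,
      AddSubmonoidClass.coe_finsetSum, Submodule.coe_smul]
    rfl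
  have happ (i j : ι) {x : V} (hx : x ∈ (W j).toSubmodule) :
      charIdempotent ρ (χ i) x = if j = i then x else 0 := by
    have h := hcoe i j ⟨x, hx⟩
    rw [charIdempotent_apply_of_isIrreducible (hirr j) (hirr i)] at h
    rw [h]
    by_cases hij : j = i
    · subst hij
      simp
    · rw [if_neg hij, if_neg fun h => hij (hinj h)]
      rfl
  have hmem (i : ι) (x : V) : charIdempotent ρ (χ i) x ∈ (W i).toSubmodule := by
    have hx : x ∈ ⨆ i, (W i).toSubmodule := hsup ▸ Submodule.mem_top
    induction hx using Submodule.iSup_induction' with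
    | mem j x hx =>
      rw [happ i j hx]
      split_ifs with h
      · exact h ▸ hx
      · exact zero_mem _
    | zero => simp
    | add x y _ _ hx hy => rw [map_add]; exact add_mem hx hy
  have hsum (x : V) : ∑ i, charIdempotent ρ (χ i) x = x := by
    have hx : x ∈ ⨆ i, (W i).toSubmodule := hsup ▸ Submodule.mem_top
    induction hx using Submodule.iSup_induction' with
    | mem j x hx => simp [happ _ j hx]
    | zero => simp
    | add x y _ _ hx hy => simp only [map_add, Finset.sum_add_distrib, hx, hy]
  have hinv (i : ι) {x : V} (hx : x ∈ M.toSubmodule) :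
      charIdempotent ρ (χ i) x ∈ M.toSubmodule := by
    simp only [charIdempotent, LinearMap.sum_apply, LinearMap.smul_apply]
    exact sum_mem fun g _ => Submodule.smul_mem _ _ (M.apply_mem_toSubmodule g hx)
  -- An irreducible summand that meets `M` nontrivially lies in `M`.
  have hzero (i : ι) (hi : ¬ W i ≤ M) {x : V} (hx : x ∈ M.toSubmodule)
      (hxi : x ∈ (W i).toSubmodule) : x = 0 := by
    by_contra hx0
    let U : Subrepresentation (W i).toRepresentation :=
      { toSubmodule := M.toSubmodule.comap (W i).toSubmodule.subtype
        apply_mem_toSubmodule := fun g y hy => M.apply_mem_toSubmodule g hy }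
    rcases (hirr i).eq_bot_or_eq_top U with h | h
    · have : (⟨x, hxi⟩ : (W i).toSubmodule) ∈ U.toSubmodule := hx
      rw [h] at this
      exact hx0 (congrArg Subtype.val ((Submodule.mem_bot k).1 this))
    · refine hi fun y hy => ?_
      have : (⟨y, hy⟩ : (W i).toSubmodule) ∈ U.toSubmodule := by
        rw [h]; exact Submodule.mem_top
      exact this
  have hc (g : G) : ∑ i with W i ≤ M, χ i 1 * (Nat.card G : k)⁻¹ * χ i g⁻¹ ∈ F :=
    sum_mem fun i _ => mul_mem (mul_mem (hF i 1) (inv_mem (natCast_mem F _))) (hF i g⁻¹)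
  have hP (x : V) : ∑ g, (∑ i with W i ≤ M, χ i 1 * (Nat.card G : k)⁻¹ * χ i g⁻¹) • ρ g x =
      ∑ i with W i ≤ M, charIdempotent ρ (χ i) x := by
    simp only [charIdempotent, LinearMap.sum_apply, LinearMap.smul_apply, Finset.sum_smul]
    exact Finset.sum_comm
  refine ⟨fun g => ⟨_, hc g⟩, fun x => ?_⟩
  simp only [hP]
  constructor
  · intro hx
    rw [Finset.sum_filter]
    conv_rhs => rw [← hsum x]
    refine Finset.sum_congr rfl fun i _ => ?_
    split_ifs with hi
    · rfl
    · exact (hzero i hi (hinv i hx) (hmem i x)).symm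
  · intro hx
    rw [← hx]
    exact sum_mem fun i hi => (Finset.mem_filter.1 hi).2 (hmem i x)

end Idempotent

/-! ### Descent of linear equations to a subfield -/

section Descent

variable {F K S : Type*} [Field F] [Field K] [Algebra F K]

/-- The coordinatewise inclusion of `F[S]` into `K[S]` for a field extension `K / F`. -/
noncomputable def extendScalars (F K S : Type*) [Field F] [Field K] [Algebra F K] :
    (S →₀ F) →ₗ[F] (S →₀ K) :=
  Finsupp.mapRange.linearMap (Algebra.linearMap F K)

@[simp]
theorem extendScalars_apply (v : S →₀ F) (s : S) :
    extendScalars F K S v s = algebraMap F K (v s) := rfl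

theorem linearIndependent_extendScalars {ι : Type*} {u : ι → S →₀ F}
    (hu : LinearIndependent F u) : LinearIndependent K fun i => extendScalars F K S (u i) := by
  rw [linearIndependent_iff'] at hu ⊢
  intro t c hc i hi
  -- A functional `φ : K → F`, applied coordinatewise, turns a `K`-linear relation among vectors
  -- with entries in `F` into an `F`-linear one.
  rw [← Module.forall_dual_apply_eq_zero_iff F]
  intro φ
  refine hu t (fun i => φ (c i)) ?_ i hi
  ext s
  have h := congrArg φ (DFunLike.congr_fun hc s)
  simp only [Finsupp.coe_finsetSum, Finset.sum_apply, Finsupp.smul_apply, extendScalars_apply,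
    Finsupp.coe_zero, Pi.zero_apply, map_zero, map_sum, smul_eq_mul] at h ⊢
  rw [← h]
  refine Finset.sum_congr rfl fun j _ => ?_
  rw [mul_comm (c j), ← Algebra.smul_def, map_smul, smul_eq_mul, mul_comm]

omit [Algebra F K] in
theorem finrank_le_of_map_linearIndependent {V W : Type*} [AddCommGroup V] [Module F V]
    [AddCommGroup W] [Module K W] [FiniteDimensional F V] [FiniteDimensional K W] {j : V → W}
    (hj : ∀ {n : ℕ} {u : Fin n → V}, LinearIndependent F u → LinearIndependent K fun i => j (u i))
    {N : Submodule F V} {M : Submodule K W} (h : ∀ x ∈ N, j x ∈ M) :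
    finrank F N ≤ finrank K M := by
  have hli : LinearIndependent K fun i => (⟨_, h _ (finBasis F N i).2⟩ : M) :=
    LinearIndependent.of_comp M.subtype
      (hj ((finBasis F N).linearIndependent.map' N.subtype N.ker_subtype))
  simpa using hli.fintype_card_le_finrank

theorem finrank_le_of_extendScalars_mem [Finite S] {N : Submodule F (S →₀ F)}
    {M : Submodule K (S →₀ K)} (h : ∀ x ∈ N, extendScalars F K S x ∈ M) :
    finrank F N ≤ finrank K M :=
  finrank_le_of_map_linearIndependent (V := S →₀ F) (W := S →₀ K) (j := extendScalars F K S)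
    (fun {_ u} hu => linearIndependent_extendScalars (u := u) hu) h

/-- A nonzero solution `v` over `K` of the linear system `∑ h, c h • a h • v = v` with coefficients
in `F` yields a nonzero solution over `F` with no larger support. -/
theorem exists_descent {H : Type*} [Fintype H] (a : H → Equiv.Perm S) (c : H → F) {v : S →₀ K}
    (hv : v ≠ 0)
    (hP : ∑ h, algebraMap F K (c h) • Finsupp.lmapDomain K K (a h) v = v) :
    ∃ v₀ : S →₀ F, v₀ ≠ 0 ∧ v₀.support ⊆ v.support ∧
      ∑ h, algebraMap F K (c h) • Finsupp.lmapDomain K K (a h) (extendScalars F K S v₀) =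
        extendScalars F K S v₀ := by
  obtain ⟨s₀, hs₀⟩ := Finsupp.ne_iff.1 hv
  obtain ⟨φ, hφ⟩ : ∃ φ : K →ₗ[F] F, φ (v s₀) ≠ 0 := by
    by_contra! h
    exact hs₀ ((Module.forall_dual_apply_eq_zero_iff F _).1 h)
  -- Applying `φ` to the coordinates of `v` preserves every linear equation over `F`.
  refine ⟨v.mapRange φ (map_zero φ), fun h => hφ ?_, Finsupp.support_mapRange, ?_⟩
  · simpa using DFunLike.congr_fun h s₀
  · have hmap (h : H) (w : S →₀ K) (s : S) :
        Finsupp.lmapDomain K K (a h) w s = w ((a h).symm s) := by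
      conv_lhs => rw [← (a h).apply_symm_apply s]
      exact Finsupp.mapDomain_apply (a h).injective _ _
    ext s
    have h := congrArg φ (DFunLike.congr_fun hP s)
    simp only [Finsupp.coe_finsetSum, Finset.sum_apply, Finsupp.smul_apply, hmap,
      extendScalars_apply, Finsupp.mapRange_apply, smul_eq_mul, map_sum] at h ⊢
    rw [← h, map_sum]
    refine Finset.sum_congr rfl fun g _ => ?_
    rw [← map_mul, ← Algebra.smul_def, map_smul, smul_eq_mul]

end Descent

/-! ### The permutation module as a representation -/

section Permutation

universe u

variable {G : Type*} {S : Type u} [Group G] [MulAction Gᵐᵒᵖ S]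

/-- The left representation `σ ↦ (s ↦ σ s)` of the symmetric group of `S` on `K[S]`. -/
noncomputable def permRep (K S : Type*) [Field K] : Representation K (Equiv.Perm S) (S →₀ K) where
  toFun σ := Finsupp.lmapDomain K K σ
  map_one' := Finsupp.lmapDomain_id K K
  map_mul' σ τ := Finsupp.lmapDomain_comp K K τ σ

/-- The right action of `G` on `S` made into a left action: `g` acts as `s ↦ s g⁻¹`. -/
def leftPermHom (G S : Type*) [Group G] [MulAction Gᵐᵒᵖ S] : G →* Equiv.Perm S :=
  (MulAction.toPermHom Gᵐᵒᵖ S).comp (MulEquiv.inv' G).toMonoidHom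

/-- The left action of `g` on `K[S]` is the right action of `g⁻¹`. -/
theorem permRep_leftPermHom (K : Type*) [Field K] (g : G) :
    permRep K S (leftPermHom G S g) = translate K g⁻¹ := rfl

/-- A permutation and its inverse have equally many fixed points, so they have the same trace. -/
theorem trace_permRep_inv [Finite S] (σ : Equiv.Perm S) :
    LinearMap.trace ℂ _ (permRep ℂ S σ⁻¹) = LinearMap.trace ℂ _ (permRep ℂ S σ) := by
  classical
  have := Fintype.ofFinite S
  rw [LinearMap.trace_eq_matrix_trace ℂ Finsupp.basisSingleOne,
    LinearMap.trace_eq_matrix_trace ℂ Finsupp.basisSingleOne]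
  refine Finset.sum_congr rfl fun s _ => ?_
  have key (τ : Equiv.Perm S) (s : S) :
      permRep ℂ S τ (Finsupp.single s 1) = Finsupp.single (τ s) 1 := Finsupp.mapDomain_single
  simp only [Matrix.diag_apply, LinearMap.toMatrix_apply, Finsupp.coe_basisSingleOne, key,
    Finsupp.basisSingleOne_repr, LinearEquiv.refl_apply, Finsupp.single_apply,
    Equiv.Perm.inv_eq_iff_eq]
  simp only [eq_comm]

/-- `irrChars` is stated for representations on `Fin n → ℂ` only; an arbitrary irreducible
representation of a quotient `H` of `G` is transported there by a choice of basis. -/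
theorem character_mem_irrChars {G H V : Type*} [Group G] [Group H] [AddCommGroup V] [Module ℂ V]
    [FiniteDimensional ℂ V] {ρ : Representation ℂ H V} (hρ : ρ.IsIrreducible) {f : G →* H}
    (hf : Function.Surjective f) : (fun g => ρ.character (f g)) ∈ irrChars G := by
  let e : V ≃ₗ[ℂ] (Fin (finrank ℂ V) → ℂ) := (finBasis ℂ V).equivFun
  let σ : Representation ℂ G (Fin (finrank ℂ V) → ℂ) :=
    { toFun g := e.conj (ρ (f g))
      map_one' := by ext; simp [LinearEquiv.conj_apply]
      map_mul' g h := by ext; simp [LinearEquiv.conj_apply] }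
  have hσ (g : G) : σ g = e.conj (ρ (f g)) := rfl
  refine ⟨_, σ, isIrreducible_of_equivariant_equiv hρ f hf e fun g x => ?_, ?_⟩
  · simp [hσ, LinearEquiv.conj_apply]
  · ext g
    simp only [Representation.character, hσ, LinearMap.trace_conj']

/-- Right translation is an antihomomorphism. -/
theorem translate_mul (K : Type*) [Field K] (g h : G) (x : S →₀ K) :
    translate K (g * h) x = translate K h (translate K g x) := by
  have := DFunLike.congr_fun ((permRep K S).map_mul (leftPermHom G S h⁻¹) (leftPermHom G S g⁻¹)) x
  rwa [← map_mul, ← mul_inv_rev, permRep_leftPermHom, inv_inv, Module.End.mul_apply,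
    permRep_leftPermHom, permRep_leftPermHom, inv_inv, inv_inv] at this

theorem translate_mem_genSubmodule {K : Type*} [Field K] (v : S →₀ K) (g : G) {x : S →₀ K}
    (hx : x ∈ genSubmodule G v) : translate K g x ∈ genSubmodule G v := by
  induction hx using Submodule.span_induction with
  | mem x hx =>
    obtain ⟨h, rfl⟩ := hx
    exact Submodule.subset_span ⟨h * g, translate_mul K h g v⟩
  | zero => simp
  | add x y _ _ hx hy => rw [map_add]; exact add_mem hx hy
  | smul a x _ hx => rw [map_smul]; exact Submodule.smul_mem _ _ hx

theorem self_mem_genSubmodule {K : Type*} [Field K] (v : S →₀ K) : v ∈ genSubmodule G v :=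
  Submodule.subset_span ⟨1, by
    change translate K 1 v = v
    rw [← inv_one, ← permRep_leftPermHom, map_one, map_one, Module.End.one_apply]⟩

theorem extendScalars_translate {F K : Type*} [Field F] [Field K] [Algebra F K] (g : G)
    (x : S →₀ F) :
    extendScalars F K S (translate F g x) = translate K g (extendScalars F K S x) :=
  (Finsupp.mapDomain_mapRange _ x (algebraMap F K) (map_zero _) (map_add _)).symm

/-- The permutation character of the right action is also the character of the left action, although
the two differ by `g ↦ g⁻¹`. -/
theorem permChar_eq_character [Finite S] : permChar G S =
    fun g => Representation.character ((permRep ℂ S).comp (leftPermHom G S).range.subtype)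
      ((leftPermHom G S).rangeRestrict g) := by
  ext g
  change _ = LinearMap.trace ℂ _ (permRep ℂ S (leftPermHom G S g))
  rw [← trace_permRep_inv, ← map_inv, permRep_leftPermHom, inv_inv]
  rfl

/-- A representation of a finite quotient `H` of `G` decomposes into irreducible summands. If its
character is multiplicity-free as a character of `G`, then the summands have distinct characters,
with values in the field generated by the irreducible constituents. -/
theorem exists_isInternal_of_isMultiplicityFree {H : Type*} {V : Type u} [Group H] [Finite H]
    [AddCommGroup V] [Module ℂ V] [FiniteDimensional ℂ V] (ρ : Representation ℂ H V) {f : G →* H}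
    (hf : Function.Surjective f) {π : G → ℂ} (hρ : π = fun g => ρ.character (f g))
    (hπ : IsMultiplicityFree π) :
    ∃ (ι : Type u) (_ : Fintype ι) (_ : DecidableEq ι) (W : ι → Subrepresentation ρ),
      (∀ i, (W i).toRepresentation.IsIrreducible) ∧
      (DirectSum.IsInternal fun i => (W i).toSubmodule) ∧
      (Function.Injective fun i => (W i).toRepresentation.character) ∧
      ∀ i h, (W i).toRepresentation.character h ∈ constituentField π := by
  obtain ⟨ι, hι, hdec, W, hirr, hW⟩ := exists_isInternal_irreducible ρ
  refine ⟨ι, hι, hdec, W, hirr, hW, ?_⟩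
  let χ (i : ι) (g : G) : ℂ := (W i).toRepresentation.character (f g)
  have hX : IsIrrDecomposition π (Finset.univ.val.map χ) := by
    refine ⟨fun ψ hψ => ?_, ?_⟩
    · obtain ⟨i, -, rfl⟩ := Multiset.mem_map.1 hψ
      exact character_mem_irrChars (hirr i) hf
    · rw [Finset.sum_map_val, hρ]
      ext g
      rw [Finset.sum_apply]
      exact (LinearMap.trace_eq_sum_trace_restrict hW
        fun i => (W i).apply_mem_toSubmodule (f g)).symm
  constructor
  · intro i j hij
    refine Multiset.inj_on_of_nodup_map (hπ _ hX) i (Finset.mem_univ i) j (Finset.mem_univ j) ?_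
    exact funext fun g => congrFun hij (f g)
  · intro i h
    obtain ⟨g, rfl⟩ := hf h
    exact Subfield.subset_closure
      ⟨χ i, ⟨_, hX, Multiset.mem_map_of_mem χ (Finset.mem_univ i)⟩, g, rfl⟩

end Permutation

end PermModule

open PermModule in
theorem theorem8p3 {G S : Type*} [Group G] [Finite S] [MulAction Gᵐᵒᵖ S]
    (hπ : PermModule.IsMultiplicityFree (PermModule.permChar G S))
    (v : S →₀ ℂ) (hv : v ≠ 0) :
    ∃ v₀ : S →₀ PermModule.constituentField (PermModule.permChar G S),
      v₀ ≠ 0 ∧ PermModule.suppSize v₀ ≤ PermModule.suppSize v ∧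
        PermModule.genDim G v₀ ≤ PermModule.genDim G v := by
  classical
  obtain ⟨ι, _, _, W, hirr, hW, hinj, hF⟩ := exists_isInternal_of_isMultiplicityFree _
    (leftPermHom G S).rangeRestrict_surjective permChar_eq_character hπ
  have := Fintype.ofFinite (leftPermHom G S).range
  let M : Subrepresentation ((permRep ℂ S).comp (leftPermHom G S).range.subtype) :=
    { toSubmodule := genSubmodule G v
      apply_mem_toSubmodule := by
        rintro ⟨_, g, rfl⟩ x hx
        exact translate_mem_genSubmodule v g⁻¹ hx }
  obtain ⟨c, hc⟩ := exists_mem_iff_sum_smul_eq hirr hW hinj _ hF M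
  obtain ⟨v₀, hv₀, hsupp, hfix⟩ := exists_descent
    (fun h : (leftPermHom G S).range => (h : Equiv.Perm S)) c hv
    ((hc v).1 (self_mem_genSubmodule v))
  refine ⟨v₀, hv₀, Finset.card_le_card hsupp, finrank_le_of_extendScalars_mem fun x hx => ?_⟩
  have hmem : extendScalars _ ℂ S v₀ ∈ genSubmodule G v := (hc _).2 hfix
  induction hx using Submodule.span_induction with
  | mem x hx =>
    obtain ⟨g, rfl⟩ := hx
    rw [extendScalars_translate]
    exact translate_mem_genSubmodule v g hmem
  | zero => simp
  | add x y _ _ hx hy => rw [map_add]; exact add_mem hx hy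
  | smul a x _ hx =>
    rw [map_smul, Subfield.smul_def]
    exact Submodule.smul_mem _ _ hx
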